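/- Let $\mathcal{A},\mathcal{B}$ be finite discrete alphabets, and let $X\subseteq\mathcal{A}^{\mathbb{Z}}$, $Y\subseteq\mathcal{B}^{\mathbb{Z}}$ be nonempty two-sided shifts of finite type, with left shift maps $T:X\to X$ and $S:Y\to Y$. Assume that $X$ and $Y$ are \emph{transitive} in the following sense (for $X$, and similarly for $Y$): there is $D\in\mathbb{N}$ such that for all $x_1,x_2\in X$ and all $b_1,a_2\in\mathbb{Z}$ with $a_2-b_1\ge D$ there is $x'\in X$ with $x'(j)=x_1(j)$ for all $j\le b_1$ and $x'(j)=x_2(j)$ for all $j\ge a_2$. Let $f:X\times Y\to\mathbb{R}$ be locally constant, i.e. there is $L\in\mathbb{N}$ such that $f(x,y)$ depends only on the restrictions of $x$ and $y$ to $[-L,L]$. Let $\mathcal{M}_S(Y)$ and $\mathcal{M}_{T\times S}(X\times Y)$ be the sets of invariant Borel probability measures, let $\pi:X\times Y\to Y$ be the projection, and for $\nu\in\mathcal{M}_S(Y)$ put $$\psi_f(\nu)=\min\left\{\int f\,\mathrm{d}\lambda : \lambda\in\mathcal{M}_{T\times S}(X\times Y),\ \pi_*\lambda=\nu\right\}.$$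 Call $\nu\in\mathcal{M}_S(Y)$ \emph{$\alpha$-maximizing} for $f$ if $\psi_f(\nu)=\sup_{\nu'\in\mathcal{M}_S(Y)}\psi_f(\nu')$. If $\nu_0,\nu_1\in\mathcal{M}_S(Y)$, $\nu_0$ is $\alpha$-maximizing for $f$, and $\operatorname{supp}(\nu_1)\subseteq\operatorname{supp}(\nu_0)$, then $\nu_1$ is $\alpha$-maximizing for $f$. -/

import Mathlib

open MeasureTheory SymbolicDynamics.FullShift

namespace AdversarialErgodic

/-! ### Invariant measures, the functional `ψ_f` and `α`-maximizing measures -/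

section General

variable {Z Y : Type*} [MeasurableSpace Z] [MeasurableSpace Y]

/-- `𝓜_U(Z)`: the `U`-invariant probability measures on `Z`. -/
def invariantMeasures (U : Z → Z) : Set (ProbabilityMeasure Z) :=
  {μ | MeasurePreserving U (μ : Measure Z) (μ : Measure Z)}

/-- The `U`-invariant probability measures `μ` on `Z` with `π_* μ = ν`. -/
def invariantLifts (U : Z → Z) (π : Z → Y) (ν : ProbabilityMeasure Y) :
    Set (ProbabilityMeasure Z) :=
  {μ | μ ∈ invariantMeasures U ∧ (μ : Measure Z).map π = (ν : Measure Y)}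

variable [TopologicalSpace Z]

/-- `ψ_f(ν) = min {∫ f dμ : μ ∈ 𝓜_U(Z), π_* μ = ν}`, for a factor map `π` from `(Z, U)`.
The infimum is a minimum, see `exists_psi_eq_integral`. -/
noncomputable def psi (U : Z → Z) (π : Z → Y) (f : C(Z, ℝ)) (ν : ProbabilityMeasure Y) : ℝ :=
  sInf ((fun μ : ProbabilityMeasure Z => ∫ z, f z ∂(μ : Measure Z)) '' invariantLifts U π ν)

/-- `ν₀ ∈ 𝓜_S(Y)` is `α`-maximizing for `f` if `ψ_f : 𝓜_S(Y) → ℝ` attains its supremum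
at `ν₀`. -/
def IsAlphaMaximizing (U : Z → Z) (S : Y → Y) (π : Z → Y) (f : C(Z, ℝ))
    (ν₀ : ProbabilityMeasure Y) : Prop :=
  ν₀ ∈ invariantMeasures S ∧ IsMaxOn (psi U π f) (invariantMeasures S) ν₀

end General

/-- On a compact metrizable system the infimum defining `ψ_f(ν)` is attained (as soon as `ν` has
an invariant lift). -/
theorem exists_psi_eq_integral {Z Y : Type*}
    [TopologicalSpace Z] [CompactSpace Z] [TopologicalSpace.MetrizableSpace Z]
    [MeasurableSpace Z] [BorelSpace Z]
    [TopologicalSpace Y] [TopologicalSpace.MetrizableSpace Y] [MeasurableSpace Y] [BorelSpace Y]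
    (U : Z → Z) (π : Z → Y) (hU : Continuous U) (hπ : Continuous π) (f : C(Z, ℝ))
    (ν : ProbabilityMeasure Y) (hν : (invariantLifts U π ν).Nonempty) :
    ∃ μ ∈ invariantLifts U π ν, psi U π f ν = ∫ z, f z ∂(μ : Measure Z) ∧
      ∀ μ' ∈ invariantLifts U π ν, psi U π f ν ≤ ∫ z, f z ∂(μ' : Measure Z) := by
  have hset : invariantLifts U π ν =
      {μ | μ.map hU.measurable.aemeasurable = μ} ∩ {μ | μ.map hπ.measurable.aemeasurable = ν} := by
    ext μ
    constructor
    · rintro ⟨h1, h2⟩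
      exact ⟨Subtype.ext h1.map_eq, Subtype.ext h2⟩
    · rintro ⟨h1, h2⟩
      exact ⟨⟨hU.measurable, congrArg Subtype.val h1⟩, congrArg Subtype.val h2⟩
  have hc : IsCompact (invariantLifts U π ν) := by
    rw [hset]
    refine IsClosed.isCompact (IsClosed.inter ?_ ?_)
    · exact isClosed_eq (ProbabilityMeasure.continuous_map hU) continuous_id
    · exact isClosed_eq (ProbabilityMeasure.continuous_map hπ) continuous_const
  have hf : Continuous fun μ : ProbabilityMeasure Z => ∫ z, f z ∂(μ : Measure Z) :=
    ProbabilityMeasure.continuous_integral_boundedContinuousFunction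
      (BoundedContinuousFunction.mkOfCompact f)
  obtain ⟨μ, hμ, heq, hle⟩ := hc.exists_sInf_image_eq_and_le hν hf.continuousOn
  exact ⟨μ, hμ, heq, fun μ' h => heq.le.trans (hle μ' h)⟩

/-! ### Shifts of finite type

Shifts on `A` are the (nonempty) two-sided subshifts `SymbolicDynamics.FullShift.Subshift A ℤ`. -/

section Shifts

variable {A B : Type*} [TopologicalSpace A] [TopologicalSpace B]

/-- The left shift `(T x) j = x (j + 1)` on a subshift `X`. -/
def leftShift (X : Subshift A ℤ) (x : X.carrier) : X.carrier :=
  ⟨fun j => (x : ℤ → A) (j + 1), by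
    have h := X.mapsTo 1 x.2
    have e : shift (1 : ℤ) (x : ℤ → A) = fun j => (x : ℤ → A) (j + 1) := by
      funext j
      simp [shift, add_comm]
    rwa [e] at h⟩

/-- `X` is an `M`-step shift of finite type: it is nonempty, and it consists of all sequences none
of whose blocks of length `M + 1` belongs to some set `F` of forbidden blocks. -/
def IsStepSFT (M : ℕ) (X : Subshift A ℤ) : Prop :=
  X.carrier.Nonempty ∧ ∃ F : Set (Fin (M + 1) → A),
    X.carrier = {x | ∀ j : ℤ, (fun i : Fin (M + 1) => x (j + (i : ℕ))) ∉ F}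

/-- `X` is a shift of finite type. -/
def IsSFT (X : Subshift A ℤ) : Prop :=
  ∃ M : ℕ, IsStepSFT M X

/-- Transitivity, in the sense of gluing with a uniform gap: there is `D` such that any left ray
`x₁|_{(-∞, b₁]}` and any right ray `x₂|_{[a₂, ∞)}` of points of `X` with `a₂ - b₁ ≥ D`
extend to a common point of `X`. -/
def IsGluingTransitive (X : Subshift A ℤ) : Prop :=
  ∃ D : ℕ, ∀ x₁ ∈ X.carrier, ∀ x₂ ∈ X.carrier, ∀ b₁ a₂ : ℤ, (D : ℤ) ≤ a₂ - b₁ →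
    ∃ x' ∈ X.carrier, (∀ j ≤ b₁, x' j = x₁ j) ∧ (∀ j ≥ a₂, x' j = x₂ j)

/-- `f : X × Y → ℝ` is locally constant: `f (x, y)` depends only on the blocks
`x|_{[-L, L]}`, `y|_{[-L, L]}` for some `L`. -/
def IsLocallyConstantFun (X : Subshift A ℤ) (Y : Subshift B ℤ)
    (f : X.carrier × Y.carrier → ℝ) : Prop :=
  ∃ L : ℕ, ∀ p q : X.carrier × Y.carrier,
    (∀ j ∈ Set.Icc (-(L : ℤ)) (L : ℤ),
      (p.1 : ℤ → A) j = (q.1 : ℤ → A) j ∧ (p.2 : ℤ → B) j = (q.2 : ℤ → B) j) →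
    f p = f q

end Shifts

end AdversarialErgodic

/-! Write `F n y` for the minimum over `x` of the Birkhoff sums of `f` of length `n` at `(x, y)`.
Splitting an orbit shows that `F` is superadditive, and gluing minimizers in `X` shows that it is
subadditive up to a constant `C` (`exists_fiberMin_add_le`). Hence `n * ψ ν - C ≤ ∫ F n dν ≤ n * ψ
ν` for `n ≠ 0` and every invariant `ν`; the left bound comes from a lift built in the fibre over `ν`
(`exists_invariantLift_le`), the right one from `integral_fiberMin_le`.

Let `β` be the maximum of `ψ` and `G n = F n - n * β`. Any block of `Y` lies on a periodic orbit of
slightly longer period (`exists_periodic_agree`), whose orbit measure has `ψ ≤ β`, so `G n ≤ K`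
uniformly. The integrals of `G n` against `ν₀` are at least `-C`. If some `G n` were very negative
at a point of the support of `ν₀`, it would be so on an open set of positive measure, and recurrent
visits there would drive these integrals to `-∞` (`le_of_mem_support`). So `G n` is bounded below on
that support, hence `ν₁`-almost everywhere; integrating and letting `n` grow gives `ψ ν₁ ≥ β`. -/

namespace AdversarialErgodic

open Filter Topology
open scoped ENNReal

/-! ### Orbit averages of measures -/

section OrbitAverage

variable {Z W : Type*} [MeasurableSpace Z] [MeasurableSpace W]

/-- The average of the push-forwards of `μ` under the first `n` iterates of `U`. -/
noncomputable def orbitAverage (U : Z → Z) (n : ℕ) (μ : Measure Z) : Measure Z :=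
  (n : ℝ≥0∞)⁻¹ • ∑ i ∈ Finset.range n, μ.map U^[i]

theorem isProbabilityMeasure_orbitAverage {U : Z → Z} (hU : Measurable U) {n : ℕ} (hn : n ≠ 0)
    (μ : Measure Z) [IsProbabilityMeasure μ] : IsProbabilityMeasure (orbitAverage U n μ) := by
  constructor
  have h : ∀ i ∈ Finset.range n, (μ.map U^[i]) Set.univ = 1 := fun i _ => by
    rw [Measure.map_apply (hU.iterate i) MeasurableSet.univ, Set.preimage_univ, measure_univ]
  simp only [orbitAverage, Measure.smul_apply, Measure.coe_finsetSum, Finset.sum_apply]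
  rw [Finset.sum_congr rfl h]
  simp only [Finset.sum_const, Finset.card_range, nsmul_eq_mul, mul_one, smul_eq_mul]
  exact ENNReal.inv_mul_cancel (by exact_mod_cast hn) (ENNReal.natCast_ne_top n)

theorem map_orbitAverage {U : Z → Z} (hU : Measurable U) {V : W → W} {π : Z → W}
    (hπ : Measurable π) (hπU : Function.Semiconj π U V) {n : ℕ} (hn : n ≠ 0)
    (μ : Measure Z) {ν : Measure W} (hν : MeasurePreserving V ν ν) (hμ : μ.map π = ν) :
    (orbitAverage U n μ).map π = ν := by
  have h : ∀ i ∈ Finset.range n, (μ.map U^[i]).map π = ν := fun i _ => by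
    rw [Measure.map_map hπ (hU.iterate i), (hπU.iterate_right i).comp_eq,
      ← Measure.map_map (hν.measurable.iterate i) hπ, hμ, (hν.iterate i).map_eq]
  rw [orbitAverage, Measure.map_smul, Measure.map_finset_sum hπ.aemeasurable,
    Finset.sum_congr rfl h, Finset.sum_const, Finset.card_range, ← Nat.cast_smul_eq_nsmul ℝ≥0∞,
    smul_smul, ENNReal.inv_mul_cancel (by exact_mod_cast hn) (ENNReal.natCast_ne_top n), one_smul]

theorem measurePreserving_orbitAverage_dirac {U : Z → Z} (hU : Measurable U) {n : ℕ} {z : Z}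
    (hz : U^[n] z = z) :
    MeasurePreserving U (orbitAverage U n (Measure.dirac z))
      (orbitAverage U n (Measure.dirac z)) := by
  refine ⟨hU, ?_⟩
  have h : ∀ i : ℕ, (Measure.dirac z).map U^[i] = Measure.dirac (U^[i] z) := fun i =>
    Measure.map_dirac' (hU.iterate i) z
  simp only [orbitAverage, h]
  rw [Measure.map_smul, Measure.map_finset_sum hU.aemeasurable]
  simp only [Measure.map_dirac' hU, ← Function.iterate_succ_apply']
  congr 1
  -- Peeling the last or the first term off the sum over `n + 1` points leaves the same Dirac mass
  -- at `z`, which cancels because it is finite.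
  have h1 := Finset.sum_range_succ (fun i => Measure.dirac (U^[i] z)) n
  rw [Finset.sum_range_succ', hz, Function.iterate_zero_apply] at h1
  ext s hs
  have h2 := congrArg (fun m : Measure Z => m s) h1
  simp only [Measure.add_apply] at h2
  exact (ENNReal.add_left_inj (measure_ne_top _ _)).1 h2

end OrbitAverage

/-! ### Invariant lifts by averaging on a compact space -/

section Compact

variable {Z : Type*} [TopologicalSpace Z] [CompactSpace Z] [MeasurableSpace Z] [BorelSpace Z]

theorem continuous_birkhoffSum {Z : Type*} [TopologicalSpace Z] {U : Z → Z} (hU : Continuous U)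
    {g : Z → ℝ} (hg : Continuous g) (n : ℕ) : Continuous (birkhoffSum U g n) :=
  continuous_finsetSum _ fun i _ => hg.comp (hU.iterate i)

theorem integrable_of_continuous {g : Z → ℝ} (hg : Continuous g) (μ : Measure Z)
    [IsFiniteMeasure μ] : Integrable g μ :=
  (BoundedContinuousFunction.mkOfCompact ⟨g, hg⟩).integrable μ

theorem integral_orbitAverage {U : Z → Z} (hU : Continuous U) {g : Z → ℝ} (hg : Continuous g)
    (n : ℕ) (μ : Measure Z) [IsFiniteMeasure μ] :
    ∫ z, g z ∂(orbitAverage U n μ) = (n : ℝ)⁻¹ * ∫ z, birkhoffSum U g n z ∂μ := by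
  have hi : ∀ i, Integrable g (μ.map U^[i]) := fun i => integrable_of_continuous hg _
  have hs : ∀ i, ∫ z, g z ∂(μ.map U^[i]) = ∫ z, g (U^[i] z) ∂μ := fun i =>
    integral_map (hU.iterate i).measurable.aemeasurable (hi i).aestronglyMeasurable
  rw [orbitAverage, integral_smul_measure, integral_finsetSum_measure fun i _ => hi i]
  simp only [birkhoffSum, hs]
  rw [integral_finsetSum (f := fun i z => g (U^[i] z)) _ fun i _ =>
    integrable_of_continuous (hg.comp (hU.iterate i)) μ]
  simp

theorem integral_birkhoffSum {U : Z → Z} {μ : Measure Z} [IsFiniteMeasure μ]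
    (hμ : MeasurePreserving U μ μ) (hU : Continuous U) {g : Z → ℝ} (hg : Continuous g) (n : ℕ) :
    ∫ z, birkhoffSum U g n z ∂μ = n * ∫ z, g z ∂μ := by
  have h : ∀ i ∈ Finset.range n, ∫ z, g (U^[i] z) ∂μ = ∫ z, g z ∂μ := fun i _ => by
    have hm := (hμ.iterate i)
    conv_rhs => rw [← hm.map_eq]
    exact (integral_map hm.measurable.aemeasurable
      (integrable_of_continuous hg _).aestronglyMeasurable).symm
  simp only [birkhoffSum]
  rw [integral_finsetSum (f := fun i z => g (U^[i] z)) _ fun i _ =>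
    integrable_of_continuous (hg.comp (hU.iterate i)) μ,
    Finset.sum_congr rfl h]
  simp

/-- Krylov–Bogoliubov construction inside the fibre over an invariant measure `ν`: lifts of `ν`
along which long Birkhoff averages of `f` are at most `c` on average yield an invariant lift with
`∫ f ≤ c`. -/
theorem exists_invariantLift_integral_le [TopologicalSpace.MetrizableSpace Z] {W : Type*}
    [TopologicalSpace W] [TopologicalSpace.MetrizableSpace W] [MeasurableSpace W] [BorelSpace W]
    {U : Z → Z} (hU : Continuous U) {V : W → W} {π : Z → W} (hπ : Continuous π)
    (hπU : Function.Semiconj π U V) (f : C(Z, ℝ)) {ν : ProbabilityMeasure W}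
    (hν : ν ∈ invariantMeasures V) {c : ℝ}
    (h : ∀ N : ℕ, ∃ n, N < n ∧ ∃ κ : ProbabilityMeasure Z, (κ : Measure Z).map π = ν ∧
      ∫ z, birkhoffSum U f n z ∂(κ : Measure Z) ≤ n * c) :
    ∃ μ ∈ invariantLifts U π ν, ∫ z, f z ∂(μ : Measure Z) ≤ c := by
  choose n hn κ hκ hκf using h
  have hn0 : ∀ k, n k ≠ 0 := fun k => ((Nat.zero_le k).trans_lt (hn k)).ne'
  let l : ℕ → ProbabilityMeasure Z := fun k =>
    ⟨orbitAverage U (n k) (κ k), isProbabilityMeasure_orbitAverage hU.measurable (hn0 k) _⟩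
  have hint : ∀ (g : Z → ℝ), Continuous g → ∀ k, ∫ z, g z ∂(l k : Measure Z) =
      (n k : ℝ)⁻¹ * ∫ z, birkhoffSum U g (n k) z ∂(κ k : Measure Z) := fun g hg k =>
    integral_orbitAverage hU hg _ _
  have hlπ : ∀ k, (l k).map hπ.measurable.aemeasurable = ν := fun k =>
    Subtype.ext (map_orbitAverage hU.measurable hπ.measurable hπU (hn0 k) _ hν (hκ k))
  -- Compactness of the space of probability measures gives a limit along an ultrafilter, with no
  -- subsequence to extract.
  set F := Ultrafilter.map l (hyperfilter ℕ)
  let μ : ProbabilityMeasure Z := F.lim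
  have hlim : Tendsto l (hyperfilter ℕ : Filter ℕ) (𝓝 μ) := F.le_nhds_lim
  have hle : (hyperfilter ℕ : Filter ℕ) ≤ atTop := by
    rw [← Nat.cofinite_eq_atTop]; exact hyperfilter_le_cofinite
  have hconv := ProbabilityMeasure.tendsto_iff_forall_integral_tendsto.1 hlim
  refine ⟨μ, ⟨⟨hU.measurable, ?_⟩, ?_⟩, ?_⟩
  · refine ext_of_forall_integral_eq_of_IsFiniteMeasure fun g => ?_
    rw [integral_map hU.measurable.aemeasurable g.continuous.aestronglyMeasurable]
    have h1 := hconv (g.compContinuous ⟨U, hU⟩)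
    have h2 := hconv g
    refine sub_eq_zero.1 (tendsto_nhds_unique (h1.sub h2) ?_)
    have h3 : Tendsto (fun k : ℕ => (2 * ‖g‖) * (1 / ((k : ℝ) + 1))) (hyperfilter ℕ : Filter ℕ)
        (𝓝 0) := by
      have := (tendsto_one_div_add_atTop_nhds_zero_nat (𝕜 := ℝ)).const_mul (2 * ‖g‖)
      rw [mul_zero] at this
      exact this.mono_left hle
    refine squeeze_zero_norm (fun k => ?_) h3
    have hgU : Continuous fun z => g (U z) := g.continuous.comp hU
    have e1 : ∫ z, (g.compContinuous ⟨U, hU⟩) z ∂(l k : Measure Z) =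
        (n k : ℝ)⁻¹ * ∫ z, birkhoffSum U (fun z => g (U z)) (n k) z ∂(κ k : Measure Z) :=
      hint _ hgU k
    rw [e1, hint g g.continuous k, ← mul_sub, ← integral_sub
      (integrable_of_continuous (continuous_birkhoffSum hU hgU _) _)
      (integrable_of_continuous (continuous_birkhoffSum hU g.continuous _) _), norm_mul]
    -- Telescoping leaves two boundary terms, so the defect of invariance is at most `2 * ‖g‖ / n
    -- k`.
    have hb : ∀ z, birkhoffSum U (fun z => g (U z)) (n k) z - birkhoffSum U g (n k) z =
        g (U^[n k] z) - g z := fun z => by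
      rw [← birkhoffSum_apply_sub_birkhoffSum U g (n k) z]
      simp only [birkhoffSum, ← Function.iterate_succ_apply', ← Function.iterate_succ_apply]
    have hle2 : ‖∫ z, (birkhoffSum U (fun z => g (U z)) (n k) z - birkhoffSum U g (n k) z)
        ∂(κ k : Measure Z)‖ ≤ 2 * ‖g‖ := by
      refine (norm_integral_le_of_norm_le_const (C := 2 * ‖g‖) (ae_of_all _ fun z => ?_)).trans ?_
      · rw [hb, two_mul]
        exact (norm_sub_le _ _).trans (add_le_add (g.norm_coe_le_norm _) (g.norm_coe_le_norm _))
      · simp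
    have hk : ((k : ℝ) + 1) ≤ n k := by exact_mod_cast hn k
    have hk' : ‖(n k : ℝ)⁻¹‖ ≤ 1 / ((k : ℝ) + 1) := by
      rw [Real.norm_of_nonneg (by positivity), ← one_div]
      exact one_div_le_one_div_of_le (by positivity) hk
    rw [mul_comm (2 * ‖g‖)]
    exact mul_le_mul hk' hle2 (norm_nonneg _) (by positivity)
  · have h1 : Tendsto (fun k => (l k).map hπ.measurable.aemeasurable) (hyperfilter ℕ : Filter ℕ)
        (𝓝 (μ.map hπ.measurable.aemeasurable)) :=
      ((ProbabilityMeasure.continuous_map hπ).tendsto _).comp hlim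
    simp only [hlπ] at h1
    have h2 : μ.map hπ.measurable.aemeasurable = ν := tendsto_nhds_unique h1 tendsto_const_nhds
    exact congrArg Subtype.val h2
  · refine le_of_tendsto (hconv (BoundedContinuousFunction.mkOfCompact f))
      (Eventually.of_forall fun k => ?_)
    have hp : (0 : ℝ) < n k := by exact_mod_cast Nat.pos_of_ne_zero (hn0 k)
    refine (hint f f.continuous k).trans_le ?_
    rw [inv_mul_le_iff₀ hp]
    exact hκf k

end Compact

/-! ### Almost subadditive sequences and recurrence -/

section Subadditive

variable {Y : Type*}

/-- If `G` is subadditive up to the constant `C`, bounded above by `K`, and very negative at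
time `n` on `V`, then `G N` decays linearly in the number of visits to `V`. -/
theorem le_sub_birkhoffSum_indicator {S : Y → Y} {G : ℕ → Y → ℝ} {C K : ℝ}
    (hsub : ∀ n m y, G (n + m) y ≤ G n y + G m (S^[n] y) + C) (hub : ∀ n y, G n y ≤ K)
    {n : ℕ} (hn : n ≠ 0) {V : Set Y} (hV : ∀ y ∈ V, G n y ≤ -(2 * C + K + 1)) (N : ℕ) :
    ∀ y, G N y ≤ K + 1 - (n : ℝ)⁻¹ * birkhoffSum S (V.indicator 1) N y := by
  have hn' : (0 : ℝ) < n := by exact_mod_cast Nat.pos_of_ne_zero hn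
  have hle : ∀ (m : ℕ) (y : Y), birkhoffSum S (V.indicator (1 : Y → ℝ)) m y ≤ m := fun m y => by
    have h : ∀ i ∈ Finset.range m, V.indicator (1 : Y → ℝ) (S^[i] y) ≤ 1 := fun i _ =>
      Set.indicator_le_self' (fun _ _ => zero_le_one) _
    simpa [birkhoffSum] using Finset.sum_le_sum h
  induction N using Nat.strong_induction_on with
  | _ N ih =>
    intro y
    by_cases hvis : ∃ t, t < N ∧ S^[t] y ∈ V
    · obtain ⟨t, htN, htV, hmin⟩ : ∃ t, t < N ∧ S^[t] y ∈ V ∧ ∀ i < t, S^[i] y ∉ V := by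
        classical
        obtain ⟨h1, h2⟩ := Nat.find_spec hvis
        exact ⟨Nat.find hvis, h1, h2, fun i hi hiV => Nat.find_min hvis hi ⟨hi.trans h1, hiV⟩⟩
      have h0 : birkhoffSum S (V.indicator (1 : Y → ℝ)) t y = 0 :=
        Finset.sum_eq_zero fun i hi => Set.indicator_of_notMem (hmin i (Finset.mem_range.1 hi)) _
      -- With `t` the first visit and at most `n` steps left, the visits cost at most `1`, which the
      -- slack in `K + 1` absorbs.
      by_cases hNt : N ≤ t + n
      · obtain ⟨r, rfl⟩ := Nat.exists_eq_add_of_le htN.le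
        have h1 := hle r (S^[t] y)
        have hr : (r : ℝ) ≤ n := by exact_mod_cast (by omega : r ≤ n)
        rw [birkhoffSum_add, h0, zero_add]
        have h2 : (n : ℝ)⁻¹ * birkhoffSum S (V.indicator (1 : Y → ℝ)) r (S^[t] y) ≤ 1 := by
          rw [inv_mul_le_iff₀ hn']; linarith
        linarith [hub (t + r) y]
      -- Cut the orbit at `t` and `t + n`. The two cuts cost `2 * C` and the first piece at most
      -- `K`, so the middle piece leaves a net gain of `1`, which pays for the at most `n` visits
      -- during it.
      · obtain ⟨r, rfl⟩ := Nat.exists_eq_add_of_le (not_le.1 hNt).le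
        have h1 := hle n (S^[t] y)
        have h2 : (n : ℝ)⁻¹ * birkhoffSum S (V.indicator (1 : Y → ℝ)) n (S^[t] y) ≤ 1 := by
          rw [inv_mul_le_iff₀ hn']; linarith
        have h3 := ih r (by omega) (S^[t + n] y)
        have h4 := hsub (t + n) r y
        have h5 := hsub t n y
        have h6 := hV _ htV
        have h7 := hub t y
        rw [birkhoffSum_add, birkhoffSum_add, h0, mul_add, mul_add, mul_zero, zero_add]
        linarith
    · push Not at hvis
      have h0 : birkhoffSum S (V.indicator (1 : Y → ℝ)) N y = 0 :=
        Finset.sum_eq_zero fun i hi => Set.indicator_of_notMem (hvis i (Finset.mem_range.1 hi)) _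
      rw [h0]
      linarith [hub N y]

/-- A sequence `G` which is subadditive up to a constant, bounded above, and whose integrals
against an invariant measure are bounded below is bounded below on the support. -/
theorem le_of_mem_support [TopologicalSpace Y] [CompactSpace Y] [MeasurableSpace Y] [BorelSpace Y]
    {S : Y → Y} {ν : Measure Y} [IsFiniteMeasure ν] (hS : MeasurePreserving S ν ν)
    {G : ℕ → Y → ℝ} (hG : ∀ n, Continuous (G n)) {C K c : ℝ}
    (hsub : ∀ n m y, G (n + m) y ≤ G n y + G m (S^[n] y) + C) (hub : ∀ n y, G n y ≤ K)
    (hint : ∀ n, c ≤ ∫ y, G n y ∂ν) {n : ℕ} (hn : n ≠ 0) {y : Y} (hy : y ∈ ν.support) :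
    -(2 * C + K + 1) ≤ G n y := by
  by_contra! hlt
  set V : Set Y := {z | G n z < -(2 * C + K + 1)} with hVdef
  have hVo : IsOpen V := isOpen_lt (hG n) continuous_const
  have hpos : 0 < ν.real V :=
    ENNReal.toReal_pos ((Measure.mem_support_iff_forall y).1 hy V (hVo.mem_nhds hlt)).ne'
      (measure_ne_top _ _)
  have hn' : (0 : ℝ) < n := by exact_mod_cast Nat.pos_of_ne_zero hn
  have hVi : ∀ i : ℕ, Integrable (fun z => V.indicator (1 : Y → ℝ) (S^[i] z)) ν := fun i =>
    (hS.iterate i).integrable_comp_of_integrable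
      ((integrable_const (1 : ℝ)).indicator hVo.measurableSet)
  have hVint : ∀ i : ℕ, ∫ z, V.indicator (1 : Y → ℝ) (S^[i] z) ∂ν = ν.real V := fun i => by
    have hm := hS.iterate i
    rw [← integral_indicator_one hVo.measurableSet]
    conv_rhs => rw [← hm.map_eq]
    refine (integral_map hm.measurable.aemeasurable ?_).symm
    exact ((measurable_one.indicator hVo.measurableSet)).aestronglyMeasurable
  have hsum : ∀ N : ℕ, ∫ z, birkhoffSum S (V.indicator (1 : Y → ℝ)) N z ∂ν = N * ν.real V := by
    intro N
    simp only [birkhoffSum]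
    rw [integral_finsetSum _ fun i _ => hVi i, Finset.sum_congr rfl fun i _ => hVint i]
    simp
  have hsumi : ∀ N : ℕ, Integrable (birkhoffSum S (V.indicator (1 : Y → ℝ)) N) ν := fun N =>
    integrable_finsetSum _ fun i _ => hVi i
  have key : ∀ N : ℕ, c ≤ ν.real Set.univ * (K + 1) - (n : ℝ)⁻¹ * (N * ν.real V) := fun N => by
    refine (hint N).trans ?_
    have h := integral_mono (integrable_of_continuous (hG N) ν)
      ((integrable_const (μ := ν) (K + 1)).sub ((hsumi N).const_mul (n : ℝ)⁻¹))
      (le_sub_birkhoffSum_indicator hsub hub hn (fun z hz => (show G n z < _ from hz).le) N)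
    refine h.trans_eq ?_
    simp only [Pi.sub_apply]
    rw [integral_sub (integrable_const _) ((hsumi N).const_mul _), integral_const,
      integral_const_mul, hsum, smul_eq_mul]
  have hq : 0 < (n : ℝ)⁻¹ * ν.real V := by positivity
  obtain ⟨N, hN⟩ := exists_nat_gt ((ν.real Set.univ * (K + 1) - c) / ((n : ℝ)⁻¹ * ν.real V))
  rw [div_lt_iff₀ hq] at hN
  have := key N
  linarith [show (n : ℝ)⁻¹ * (N * ν.real V) = N * ((n : ℝ)⁻¹ * ν.real V) by ring]

end Subadditive

/-! ### Fibrewise minima of Birkhoff sums -/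

section FiberMin

variable {X Y : Type*}

/-- The minimum over the fibre above `y` of the Birkhoff sums of length `n`. -/
noncomputable def fiberMin (T : X → X) (S : Y → Y) (f : X × Y → ℝ) (n : ℕ) (y : Y) : ℝ :=
  ⨅ x, birkhoffSum (Prod.map T S) f n (x, y)

variable [TopologicalSpace X] [CompactSpace X] [TopologicalSpace Y]
  {T : X → X} {S : Y → Y} {f : X × Y → ℝ}

theorem isCompact_range_birkhoffSum (hT : Continuous T) (hS : Continuous S) (hf : Continuous f)
    (n : ℕ) (y : Y) : IsCompact (Set.range fun x => birkhoffSum (Prod.map T S) f n (x, y)) :=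
  isCompact_range ((continuous_birkhoffSum (hT.prodMap hS) hf n).comp (by fun_prop))

theorem fiberMin_le (hT : Continuous T) (hS : Continuous S) (hf : Continuous f)
    (n : ℕ) (x : X) (y : Y) : fiberMin T S f n y ≤ birkhoffSum (Prod.map T S) f n (x, y) :=
  ciInf_le (isCompact_range_birkhoffSum hT hS hf n y).bddBelow x

theorem exists_birkhoffSum_eq_fiberMin [Nonempty X] (hT : Continuous T) (hS : Continuous S)
    (hf : Continuous f) (n : ℕ) (y : Y) :
    ∃ x, birkhoffSum (Prod.map T S) f n (x, y) = fiberMin T S f n y :=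
  (isCompact_range_birkhoffSum hT hS hf n y).sInf_mem (Set.range_nonempty _)

theorem fiberMin_add_le [Nonempty X] (hT : Continuous T) (hS : Continuous S)
    (hf : Continuous f) (n m : ℕ) (y : Y) :
    fiberMin T S f n y + fiberMin T S f m (S^[n] y) ≤ fiberMin T S f (n + m) y := by
  obtain ⟨x, hx⟩ := exists_birkhoffSum_eq_fiberMin hT hS hf (n + m) y
  rw [← hx, birkhoffSum_add, Prod.map_iterate]
  exact add_le_add (fiberMin_le hT hS hf n x y) (fiberMin_le hT hS hf m (T^[n] x) (S^[n] y))

end FiberMin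

/-- Used to compare Birkhoff sums of a glued point and of its pieces, which differ only at boundedly
many times near the junction. -/
theorem sum_range_le_sum_range_add_card_mul {a b : ℕ → ℝ} {n : ℕ} {c : ℝ} (hc : 0 ≤ c)
    {s : Finset ℕ} (hs : ∀ i < n, i ∉ s → a i ≤ b i) (h : ∀ i, a i ≤ b i + c) :
    ∑ i ∈ Finset.range n, a i ≤ ∑ i ∈ Finset.range n, b i + s.card * c := by
  have h1 : ∀ i ∈ Finset.range n, a i ≤ b i + if i ∈ s then c else 0 := fun i hi => by
    split_ifs with his
    · exact h i
    · simpa using hs i (Finset.mem_range.1 hi) his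
  refine (Finset.sum_le_sum h1).trans ?_
  rw [Finset.sum_add_distrib, Finset.sum_ite_mem, Finset.sum_const, nsmul_eq_mul]
  gcongr
  exact Finset.inter_subset_right

/-! ### Locally constant functions on subshifts, and gluing in `X` -/

section Shift

variable {A B : Type*} [TopologicalSpace A] [TopologicalSpace B]

theorem iterate_leftShift_apply (X : Subshift A ℤ) (n : ℕ) (x : X.carrier) (j : ℤ) :
    ((leftShift X)^[n] x : ℤ → A) j = (x : ℤ → A) (j + n) := by
  induction n generalizing j with
  | zero => simp
  | succ n ih =>
    rw [Function.iterate_succ_apply']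
    refine (ih (j + 1)).trans ?_
    push_cast
    ring_nf

theorem continuous_leftShift (X : Subshift A ℤ) : Continuous (leftShift X) :=
  continuous_induced_rng.2 (continuous_pi fun j => (continuous_apply (j + 1)).comp
    continuous_subtype_val)

theorem exists_mem_carrier_shift (X : Subshift A ℤ) {x : ℤ → A} (hx : x ∈ X.carrier) (n : ℤ) :
    ∃ x' ∈ X.carrier, ∀ j, x' j = x (j + n) :=
  ⟨_, X.mapsTo n hx, fun j => by simp [shift, add_comm]⟩

instance compactSpace_carrier [Finite A] (X : Subshift A ℤ) : CompactSpace X.carrier :=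
  isCompact_iff_compactSpace.1 X.isClosed.isCompact

/-- `f (x, y)` depends only on the restrictions of `x` and `y` to `[-L, L]`. -/
def DependsOnWindow (X : Subshift A ℤ) (Y : Subshift B ℤ) (L : ℕ)
    (f : X.carrier × Y.carrier → ℝ) : Prop :=
  ∀ p q : X.carrier × Y.carrier,
    (∀ j ∈ Set.Icc (-(L : ℤ)) (L : ℤ),
      (p.1 : ℤ → A) j = (q.1 : ℤ → A) j ∧ (p.2 : ℤ → B) j = (q.2 : ℤ → B) j) →
    f p = f q

variable {X : Subshift A ℤ} {Y : Subshift B ℤ} {L : ℕ}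

theorem DependsOnWindow.iterate_eq {f : X.carrier × Y.carrier → ℝ} (hf : DependsOnWindow X Y L f)
    {i k : ℕ} {x x' : X.carrier} {y y' : Y.carrier}
    (hx : ∀ j ∈ Set.Icc (-(L : ℤ)) L, (x : ℤ → A) (j + i) = (x' : ℤ → A) (j + k))
    (hy : ∀ j ∈ Set.Icc (-(L : ℤ)) L, (y : ℤ → B) (j + i) = (y' : ℤ → B) (j + k)) :
    f ((Prod.map (leftShift X) (leftShift Y))^[i] (x, y)) =
      f ((Prod.map (leftShift X) (leftShift Y))^[k] (x', y')) := by
  refine hf _ _ fun j hj => ?_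
  simp only [Prod.map_iterate, Prod.map_apply, iterate_leftShift_apply]
  exact ⟨hx j hj, hy j hj⟩

theorem DependsOnWindow.birkhoffSum_eq {f : X.carrier × Y.carrier → ℝ}
    (hf : DependsOnWindow X Y L f) {n : ℕ} (x : X.carrier) {y y' : Y.carrier}
    (hy : ∀ j ∈ Set.Icc (-(L : ℤ)) (n + L), (y : ℤ → B) j = (y' : ℤ → B) j) :
    birkhoffSum (Prod.map (leftShift X) (leftShift Y)) f n (x, y) =
      birkhoffSum (Prod.map (leftShift X) (leftShift Y)) f n (x, y') := by
  refine Finset.sum_congr rfl fun i hi => hf.iterate_eq (fun _ _ => rfl) fun j hj => hy _ ?_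
  have := Finset.mem_range.1 hi
  rw [Set.mem_Icc] at hj ⊢
  omega

theorem DependsOnWindow.fiberMin_eq {f : X.carrier × Y.carrier → ℝ}
    (hf : DependsOnWindow X Y L f) {n : ℕ} {y y' : Y.carrier}
    (hy : ∀ j ∈ Set.Icc (-(L : ℤ)) (n + L), (y : ℤ → B) j = (y' : ℤ → B) j) :
    fiberMin (leftShift X) (leftShift Y) f n y = fiberMin (leftShift X) (leftShift Y) f n y' :=
  iInf_congr fun x => hf.birkhoffSum_eq x hy

/-- The restriction of the points of `Y` to `[-L, n + L]`. -/
def restrictWindow (Y : Subshift B ℤ) (L n : ℕ) (y : Y.carrier) :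
    Set.Icc (-(L : ℤ)) (n + L) → B :=
  fun j => (y : ℤ → B) j

theorem continuous_comp_restrictWindow [DiscreteTopology B] {E : Type*} [TopologicalSpace E]
    (L n : ℕ) (g : (Set.Icc (-(L : ℤ)) (n + L) → B) → E) :
    Continuous (g ∘ restrictWindow Y L n) :=
  (continuous_of_discreteTopology (f := g)).comp
    (continuous_pi fun j => (continuous_apply (j : ℤ)).comp continuous_subtype_val)

/-- One representative per block makes any function of the block factor through a discrete space,
whence its continuity. -/
theorem exists_rightInverse_restrictWindow [Nonempty Y.carrier] (L n : ℕ) :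
    ∃ e : (Set.Icc (-(L : ℤ)) (n + L) → B) → Y.carrier, ∀ y : Y.carrier,
      ∀ j ∈ Set.Icc (-(L : ℤ)) (n + L),
        (y : ℤ → B) j = (e (restrictWindow Y L n y) : ℤ → B) j := by
  classical
  refine ⟨Function.invFun (restrictWindow Y L n), fun y j hj => ?_⟩
  exact (congrFun (Function.invFun_eq (f := restrictWindow Y L n) ⟨y, rfl⟩) ⟨j, hj⟩).symm

theorem DependsOnWindow.continuous_fiberMin [DiscreteTopology B] {f : X.carrier × Y.carrier → ℝ}
    (hf : DependsOnWindow X Y L f) (n : ℕ) :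
    Continuous (fiberMin (leftShift X) (leftShift Y) f n) := by
  rcases isEmpty_or_nonempty Y.carrier with h | h
  · exact continuous_of_const fun y => isEmptyElim y
  obtain ⟨e, he⟩ := exists_rightInverse_restrictWindow (Y := Y) L n
  have h1 : fiberMin (leftShift X) (leftShift Y) f n =
      (fun w => fiberMin (leftShift X) (leftShift Y) f n (e w)) ∘ restrictWindow Y L n :=
    funext fun y => hf.fiberMin_eq (he y)
  rw [h1]
  exact continuous_comp_restrictWindow L n _

/-- Minimizers in the fibres can be selected continuously. -/
theorem DependsOnWindow.exists_continuous_minimizer [Finite A] [DiscreteTopology B]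
    [Nonempty X.carrier] {f : X.carrier × Y.carrier → ℝ} (hf : DependsOnWindow X Y L f)
    (hfc : Continuous f) (n : ℕ) :
    ∃ s : Y.carrier → X.carrier, Continuous s ∧ ∀ y,
      birkhoffSum (Prod.map (leftShift X) (leftShift Y)) f n (s y, y) =
        fiberMin (leftShift X) (leftShift Y) f n y := by
  rcases isEmpty_or_nonempty Y.carrier with h | h
  · exact ⟨fun y => isEmptyElim y, continuous_of_const fun y => isEmptyElim y,
      fun y => isEmptyElim y⟩
  obtain ⟨e, he⟩ := exists_rightInverse_restrictWindow (Y := Y) L n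
  choose s hs using exists_birkhoffSum_eq_fiberMin (f := f) (continuous_leftShift X)
    (continuous_leftShift Y) hfc n
  refine ⟨(fun w => s (e w)) ∘ restrictWindow Y L n, continuous_comp_restrictWindow L n _,
    fun y => ?_⟩
  rw [hf.fiberMin_eq (he y), ← hs, Function.comp_apply]
  exact hf.birkhoffSum_eq _ (he y)

/-- Gluing in `X` makes the fibrewise minima subadditive up to a constant. -/
theorem DependsOnWindow.exists_fiberMin_add_le [Finite A] [Finite B] [Nonempty X.carrier]
    {f : C(X.carrier × Y.carrier, ℝ)} (hf : DependsOnWindow X Y L f)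
    (hX : IsGluingTransitive X) :
    ∃ C : ℝ, 0 ≤ C ∧ ∀ n m y, fiberMin (leftShift X) (leftShift Y) f (n + m) y ≤
      fiberMin (leftShift X) (leftShift Y) f n y +
        fiberMin (leftShift X) (leftShift Y) f m ((leftShift Y)^[n] y) + C := by
  obtain ⟨D, hD⟩ := hX
  have hT := continuous_leftShift X
  have hS := continuous_leftShift Y
  set c : ℝ := 2 * ‖f‖ with hc
  have hc0 : 0 ≤ c := by positivity
  have hfc : ∀ p q, f p ≤ f q + c := fun p q => by
    have h1 := (Real.norm_eq_abs _ ▸ f.norm_coe_le_norm p : |f p| ≤ ‖f‖)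
    have h2 := (Real.norm_eq_abs _ ▸ f.norm_coe_le_norm q : |f q| ≤ ‖f‖)
    linarith [(abs_le.1 h1).2, (abs_le.1 h2).1]
  -- The glued point follows `x₁` up to `n` and the shifted `x₂` from `n + D` on. Windows of radius
  -- `L` notice this at no more than `L` times before `n` and `L + D` times after, each costing at
  -- most `c`.
  refine ⟨L * c + (L + D) * c, by positivity, fun n m y => ?_⟩
  obtain ⟨x₁, hx₁⟩ := exists_birkhoffSum_eq_fiberMin hT hS f.continuous n y
  obtain ⟨x₂, hx₂⟩ := exists_birkhoffSum_eq_fiberMin hT hS f.continuous m ((leftShift Y)^[n] y)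
  obtain ⟨x₃, hx₃X, hx₃⟩ := exists_mem_carrier_shift X x₂.2 (-n)
  obtain ⟨x', hx'X, hx'l, hx'r⟩ := hD x₁ x₁.2 x₃ hx₃X n (n + D) (by simp)
  refine (fiberMin_le hT hS f.continuous (n + m) ⟨x', hx'X⟩ y).trans ?_
  rw [birkhoffSum_add, ← hx₁, ← hx₂]
  have h1 : birkhoffSum (Prod.map (leftShift X) (leftShift Y)) f n (⟨x', hx'X⟩, y) ≤
      birkhoffSum (Prod.map (leftShift X) (leftShift Y)) f n (x₁, y) +
        (Finset.Ico (n - L) n).card * c := by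
    refine sum_range_le_sum_range_add_card_mul hc0 (fun i hi his => ?_) fun i => hfc _ _
    refine (hf.iterate_eq (fun j hj => hx'l _ ?_) fun _ _ => rfl).le
    rw [Finset.mem_Ico] at his
    rw [Set.mem_Icc] at hj
    omega
  have h2 : birkhoffSum (Prod.map (leftShift X) (leftShift Y)) f m
        ((Prod.map (leftShift X) (leftShift Y))^[n] (⟨x', hx'X⟩, y)) ≤
      birkhoffSum (Prod.map (leftShift X) (leftShift Y)) f m (x₂, (leftShift Y)^[n] y) +
        (Finset.range (L + D)).card * c := by
    refine sum_range_le_sum_range_add_card_mul hc0 (fun i hi his => ?_) fun i => hfc _ _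
    rw [Prod.map_iterate (n := n)]
    refine (hf.iterate_eq (fun j hj => ?_) fun _ _ => rfl).le
    rw [Finset.mem_range] at his
    rw [Set.mem_Icc] at hj
    rw [iterate_leftShift_apply]
    exact (hx'r _ (by omega)).trans ((hx₃ _).trans (congrArg _ (by ring)))
  have h3 : ((Finset.Ico (n - L) n).card : ℝ) * c ≤ L * c := by
    gcongr
    rw [Nat.card_Ico]
    omega
  rw [Finset.card_range] at h2
  push_cast at h2
  linarith

end Shift

/-! ### Periodic closing in `Y` -/

section Closing

variable {B : Type*} [TopologicalSpace B]

/-- Periodic closing: any block of a point of a gluing transitive shift of finite type occurs in a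
periodic point whose period exceeds the length of the block by a uniform constant. -/
theorem exists_periodic_agree {Y : Subshift B ℤ} (hY : IsSFT Y) (hYt : IsGluingTransitive Y)
    (L : ℕ) : ∃ E : ℕ, 0 < E ∧ ∀ (n : ℕ) (y : Y.carrier), ∃ y' : Y.carrier,
      (leftShift Y)^[n + E] y' = y' ∧
        ∀ j ∈ Set.Icc (-(L : ℤ)) (n + L), (y : ℤ → B) j = (y' : ℤ → B) j := by
  obtain ⟨M, -, F, hF⟩ := hY
  obtain ⟨D, hD⟩ := hYt
  -- The period `P` holds the block on `[-L, n + L]`, `M` further symbols and a gap for gluing `y`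
  -- to its translate by `P`. The resulting `x` satisfies `x (k - P) = x k` on `M + 1` consecutive
  -- places, so repeating `x` on `[-L, P - L)` creates no new block of length `M + 1`.
  refine ⟨2 * L + M + D + 1, by omega, fun n y => ?_⟩
  set P : ℤ := n + (2 * L + M + D + 1 : ℕ) with hP
  have hPpos : 0 < P := by positivity
  obtain ⟨y₂, hy₂Y, hy₂⟩ := exists_mem_carrier_shift Y y.2 (-P)
  obtain ⟨x, hxY, hxl, hxr⟩ := hD y y.2 y₂ hy₂Y (n + L + M) (P - L) (by omega)
  have hper : ∀ k : ℤ, P - L ≤ k → k ≤ P - L + M → x (k - P) = x k := fun k h1 h2 => by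
    rw [hxr k h1, hy₂, hxl _ (by omega), sub_eq_add_neg]
  set w : ℤ → B := fun j => x ((j + L) % P - L) with hw
  have hwY : w ∈ Y.carrier := by
    rw [hF] at hxY ⊢
    intro j
    have hx := hxY ((j + L) % P - L)
    convert! hx using 2
    funext i
    have hi : (i : ℤ) ≤ M := by exact_mod_cast Nat.lt_succ_iff.1 i.2
    have h0 := Int.emod_nonneg (j + L) hPpos.ne'
    have h1 := Int.emod_lt_of_pos (j + L) hPpos
    have h2 : (j + i + L) % P = ((j + L) % P + i) % P := by
      rw [Int.emod_add_emod]; ring_nf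
    change x ((j + i + L) % P - L) = x ((j + L) % P - L + i)
    rw [h2]
    by_cases hlt : (j + L) % P + i < P
    · rw [Int.emod_eq_of_lt (by positivity) hlt]
      ring_nf
    · have h3 : ((j + L) % P + i) % P = (j + L) % P + i - P := by
        rw [← Int.sub_emod_right, Int.emod_eq_of_lt (by omega) (by omega)]
      rw [h3, ← hper ((j + L) % P - L + i) (by omega) (by omega)]
      ring_nf
  refine ⟨⟨w, hwY⟩, Subtype.ext (funext fun j => ?_), fun j hj => ?_⟩
  · rw [iterate_leftShift_apply]
    change x ((j + (n + (2 * L + M + D + 1) : ℕ) + L) % P - L) = x ((j + L) % P - L)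
    have : (j + (n + (2 * L + M + D + 1) : ℕ) + L : ℤ) = j + L + P := by
      rw [hP]; push_cast; ring
    rw [this, Int.add_emod_right]
  · rw [Set.mem_Icc] at hj
    change _ = x ((j + L) % P - L)
    rw [Int.emod_eq_of_lt (by omega) (by omega), add_sub_cancel_right, hxl j (by omega)]

end Closing

/-! ### Comparison of `psi` with the integrals of fibrewise minima -/

section Main

variable {A B : Type*} [Finite A] [TopologicalSpace A] [DiscreteTopology A] [MeasurableSpace A]
  [BorelSpace A] [Finite B] [TopologicalSpace B] [DiscreteTopology B] [MeasurableSpace B]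
  [BorelSpace B] {X : Subshift A ℤ} {Y : Subshift B ℤ} {L : ℕ}

theorem DependsOnWindow.integral_fiberMin_le {f : C(X.carrier × Y.carrier, ℝ)}
    (hf : DependsOnWindow X Y L f) {ν : ProbabilityMeasure Y.carrier}
    {μ : ProbabilityMeasure (X.carrier × Y.carrier)}
    (hμ : μ ∈ invariantLifts (Prod.map (leftShift X) (leftShift Y)) Prod.snd ν) (n : ℕ) :
    ∫ y, fiberMin (leftShift X) (leftShift Y) f n y ∂(ν : Measure Y.carrier) ≤
      n * ∫ z, f z ∂(μ : Measure (X.carrier × Y.carrier)) := by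
  have hT := continuous_leftShift X
  have hS := continuous_leftShift Y
  have hF := hf.continuous_fiberMin n
  rw [← hμ.2, integral_map measurable_snd.aemeasurable hF.aestronglyMeasurable,
    ← integral_birkhoffSum hμ.1 (hT.prodMap hS) f.continuous]
  exact integral_mono (integrable_of_continuous (hF.comp continuous_snd) _)
    (integrable_of_continuous (continuous_birkhoffSum (hT.prodMap hS) f.continuous n) _)
    fun z => fiberMin_le hT hS f.continuous n z.1 z.2

/-- An invariant lift of `ν` whose integral of `f` is controlled by the fibrewise minima of the
Birkhoff sums of length `n`. -/
theorem DependsOnWindow.exists_invariantLift_le [Nonempty X.carrier]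
    {f : C(X.carrier × Y.carrier, ℝ)} (hf : DependsOnWindow X Y L f) {C : ℝ} (hC : 0 ≤ C)
    (hsub : ∀ n m y, fiberMin (leftShift X) (leftShift Y) f (n + m) y ≤
      fiberMin (leftShift X) (leftShift Y) f n y +
        fiberMin (leftShift X) (leftShift Y) f m ((leftShift Y)^[n] y) + C)
    {ν : ProbabilityMeasure Y.carrier} (hν : ν ∈ invariantMeasures (leftShift Y)) {n : ℕ}
    (hn : n ≠ 0) :
    ∃ μ ∈ invariantLifts (Prod.map (leftShift X) (leftShift Y)) Prod.snd ν,
      n * ∫ z, f z ∂(μ : Measure (X.carrier × Y.carrier)) ≤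
        ∫ y, fiberMin (leftShift X) (leftShift Y) f n y ∂(ν : Measure Y.carrier) + C := by
  have hT := continuous_leftShift X
  have hS := continuous_leftShift Y
  have hn' : (0 : ℝ) < n := by exact_mod_cast Nat.pos_of_ne_zero hn
  set a : ℕ → ℝ := fun m =>
    ∫ y, fiberMin (leftShift X) (leftShift Y) f m y ∂(ν : Measure Y.carrier) with ha
  have hint : ∀ m, Integrable (fiberMin (leftShift X) (leftShift Y) f m)
      (ν : Measure Y.carrier) := fun m => integrable_of_continuous (hf.continuous_fiberMin m) _
  have hadd : ∀ m k, a (m + k) ≤ a m + a k + C := fun m k => by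
    have hi : MeasurePreserving (leftShift Y)^[m] (ν : Measure Y.carrier) ν := hν.iterate m
    have hk := hi.integrable_comp_of_integrable (hint k)
    have he : ∫ y, fiberMin (leftShift X) (leftShift Y) f k ((leftShift Y)^[m] y)
        ∂(ν : Measure Y.carrier) = a k := by
      conv_rhs => rw [ha, ← hi.map_eq]
      exact (integral_map hi.measurable.aemeasurable
        (hf.continuous_fiberMin k).aestronglyMeasurable).symm
    have h := integral_mono (hint (m + k)) (((hint m).add hk).add (integrable_const C)) (hsub m k)
    refine h.trans_eq ?_
    rw [integral_add' ((hint m).add hk) (integrable_const C), integral_add' (hint m) hk]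
    simp only [Function.comp_apply, he]
    simp [ha]
  -- Concatenating blocks of length `n` costs `C` per junction, so the averages along multiples of
  -- `n` stay below `(a n + C) / n`.
  have hmul : ∀ k : ℕ, a ((k + 1) * n) ≤ (k + 1) * (a n + C) := fun k => by
    induction k with
    | zero => simpa using hC
    | succ k ih =>
      have h := hadd ((k + 1) * n) n
      rw [← Nat.succ_mul] at h
      push_cast
      linarith
  obtain ⟨μ, hμ, hle⟩ := exists_invariantLift_integral_le (hT.prodMap hS) continuous_snd
    (π := Prod.snd) (fun _ => rfl) f hν (c := (a n + C) / n) fun N => by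
      refine ⟨(N + 1) * n, by nlinarith [Nat.pos_of_ne_zero hn], ?_⟩
      -- The lift to be averaged is `ν` carried by the graph of a minimizing section; it need not be
      -- invariant.
      obtain ⟨s, hs, hsf⟩ := hf.exists_continuous_minimizer f.continuous ((N + 1) * n)
      have hg : Continuous fun y => (s y, y) := hs.prodMk continuous_id
      refine ⟨ν.map hg.measurable.aemeasurable, ?_, ?_⟩
      · change ((ν : Measure Y.carrier).map fun y => (s y, y)).map Prod.snd = ν
        rw [Measure.map_map measurable_snd hg.measurable]
        exact Measure.map_id
      · change ∫ z, _ ∂((ν : Measure Y.carrier).map fun y => (s y, y)) ≤ _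
        rw [integral_map hg.measurable.aemeasurable (continuous_birkhoffSum (hT.prodMap hS)
          f.continuous _).aestronglyMeasurable]
        simp only [hsf]
        refine (hmul N).trans_eq ?_
        push_cast
        field_simp
  refine ⟨μ, hμ, ?_⟩
  rwa [le_div_iff₀ hn', mul_comm] at hle

theorem exists_psi_eq_integral_prod {f : C(X.carrier × Y.carrier, ℝ)}
    {ν : ProbabilityMeasure Y.carrier}
    (hν : (invariantLifts (Prod.map (leftShift X) (leftShift Y)) Prod.snd ν).Nonempty) :
    ∃ μ ∈ invariantLifts (Prod.map (leftShift X) (leftShift Y)) Prod.snd ν,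
      psi (Prod.map (leftShift X) (leftShift Y)) Prod.snd f ν = ∫ z, f z ∂(μ : Measure _) ∧
      ∀ μ' ∈ invariantLifts (Prod.map (leftShift X) (leftShift Y)) Prod.snd ν,
        psi (Prod.map (leftShift X) (leftShift Y)) Prod.snd f ν ≤ ∫ z, f z ∂(μ' : Measure _) :=
  exists_psi_eq_integral _ _ ((continuous_leftShift X).prodMap (continuous_leftShift Y))
    continuous_snd f ν hν

end Main

/-- For an almost additive sequence `F`, the integral of `F P` against the uniform measure on a
periodic orbit of period `P` is almost the value of `F P` at any point of the orbit. -/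
theorem le_integral_orbitAverage_dirac {Y : Type*} [TopologicalSpace Y] [CompactSpace Y]
    [MeasurableSpace Y] [BorelSpace Y] {S : Y → Y} (hS : Continuous S) {F : ℕ → Y → ℝ} {C : ℝ}
    (hF : ∀ n, Continuous (F n))
    (hsup : ∀ n m y, F n y + F m (S^[n] y) ≤ F (n + m) y)
    (hsub : ∀ n m y, F (n + m) y ≤ F n y + F m (S^[n] y) + C) {P : ℕ} (hP : 0 < P) {y : Y}
    (hy : S^[P] y = y) :
    F P y - C ≤ ∫ z, F P z ∂(orbitAverage S P (Measure.dirac y)) := by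
  have hP' : (0 : ℝ) < P := by exact_mod_cast hP
  rw [integral_orbitAverage hS (hF P), integral_dirac' _ _
    (continuous_birkhoffSum hS (hF P) P).stronglyMeasurable, le_inv_mul_iff₀ hP']
  -- Cut the period at `i` and exchange the two pieces: the cut costs `C`, the reassembly nothing by
  -- superadditivity.
  have h : ∀ i ∈ Finset.range P, F P y - C ≤ F P (S^[i] y) := fun i hi => by
    obtain ⟨r, rfl⟩ := Nat.exists_eq_add_of_le (Finset.mem_range.1 hi).le
    have h1 := hsub i r y
    have h2 := hsup r i (S^[i] y)
    rw [← Function.iterate_add_apply, add_comm r i, hy] at h2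
    linarith
  simpa only [birkhoffSum, Finset.sum_const, Finset.card_range, nsmul_eq_mul]
    using Finset.sum_le_sum h

end AdversarialErgodic

/-! ### The main theorem -/

open AdversarialErgodic in
theorem mainTheorem7 {A B : Type*}
    [Finite A] [TopologicalSpace A] [DiscreteTopology A] [MeasurableSpace A] [BorelSpace A]
    [Finite B] [TopologicalSpace B] [DiscreteTopology B] [MeasurableSpace B] [BorelSpace B]
    (X : Subshift A ℤ) (Y : Subshift B ℤ)
    (hX : AdversarialErgodic.IsSFT X) (hXt : AdversarialErgodic.IsGluingTransitive X)
    (hY : AdversarialErgodic.IsSFT Y) (hYt : AdversarialErgodic.IsGluingTransitive Y)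
    (f : C(X.carrier × Y.carrier, ℝ)) (hf : AdversarialErgodic.IsLocallyConstantFun X Y f)
    (ν₀ ν₁ : ProbabilityMeasure Y.carrier)
    (hν₁ : ν₁ ∈ AdversarialErgodic.invariantMeasures (AdversarialErgodic.leftShift Y))
    (hν₀ : AdversarialErgodic.IsAlphaMaximizing
      (Prod.map (AdversarialErgodic.leftShift X) (AdversarialErgodic.leftShift Y))
      (AdversarialErgodic.leftShift Y) Prod.snd f ν₀)
    (hsupp : (ν₁ : Measure Y.carrier).support ⊆ (ν₀ : Measure Y.carrier).support) :
    AdversarialErgodic.IsAlphaMaximizing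
      (Prod.map (AdversarialErgodic.leftShift X) (AdversarialErgodic.leftShift Y))
      (AdversarialErgodic.leftShift Y) Prod.snd f ν₁ := by
  obtain ⟨L, hL⟩ := hf
  replace hL : DependsOnWindow X Y L f := hL
  obtain ⟨M, hXne, -⟩ := hX
  have : Nonempty X.carrier := hXne.to_subtype
  have hT := continuous_leftShift X
  have hS := continuous_leftShift Y
  obtain ⟨C, hC, hsub⟩ := hL.exists_fiberMin_add_le hXt
  set F := fiberMin (leftShift X) (leftShift Y) f with hFdef
  set ψ := psi (Prod.map (leftShift X) (leftShift Y)) Prod.snd f with hψ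
  have hF : ∀ n, Continuous (F n) := hL.continuous_fiberMin
  have hsup : ∀ n m y, F n y + F m ((leftShift Y)^[n] y) ≤ F (n + m) y :=
    fiberMin_add_le hT hS f.continuous
  have hlower : ∀ ν ∈ invariantMeasures (leftShift Y), ∀ n : ℕ,
      ∫ y, F n y ∂(ν : Measure Y.carrier) ≤ n * ψ ν := fun ν hν n => by
    -- Only the existence of an invariant lift matters here: it makes the infimum `ψ ν` attained.
    obtain ⟨μ, hμ, -⟩ := hL.exists_invariantLift_le hC hsub hν one_ne_zero
    obtain ⟨μ', hμ', he, -⟩ := exists_psi_eq_integral_prod (f := f) ⟨μ, hμ⟩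
    rw [hψ, he]
    exact hL.integral_fiberMin_le hμ' n
  have hupper : ∀ ν ∈ invariantMeasures (leftShift Y), ∀ n : ℕ, n ≠ 0 →
      n * ψ ν ≤ ∫ y, F n y ∂(ν : Measure Y.carrier) + C := fun ν hν n hn => by
    obtain ⟨μ, hμ, hle⟩ := hL.exists_invariantLift_le hC hsub hν hn
    obtain ⟨-, -, -, hmin⟩ := exists_psi_eq_integral_prod (f := f) ⟨μ, hμ⟩
    exact (mul_le_mul_of_nonneg_left (hmin μ hμ) n.cast_nonneg).trans hle
  obtain ⟨hν₀i, hmax⟩ := hν₀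
  replace hmax : ∀ ν ∈ invariantMeasures (leftShift Y), ψ ν ≤ ψ ν₀ := hmax
  set β := ψ ν₀ with hβ
  obtain ⟨K, hK⟩ : ∃ K, ∀ n y, F n y - n * β ≤ K := by
    obtain ⟨E, hE, hper⟩ := exists_periodic_agree hY hYt L
    obtain ⟨k, hk⟩ := (isCompact_range (hF E)).bddBelow
    -- On the periodic point, `F n y' ≤ F (n + E) y' - k` by superadditivity, and `F (n + E) y' ≤ (n
    -- + E) * β + C` by integrating over its orbit.
    refine ⟨E * β + C - k, fun n y => ?_⟩
    obtain ⟨y', hy', hag⟩ := hper n y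
    have := isProbabilityMeasure_orbitAverage hS.measurable (n := n + E) (by omega)
      (Measure.dirac y')
    have h1 := le_integral_orbitAverage_dirac hS hF hsup hsub (by omega) hy'
    have hinv : (⟨orbitAverage (leftShift Y) (n + E) (Measure.dirac y'), this⟩ :
        ProbabilityMeasure Y.carrier) ∈ invariantMeasures (leftShift Y) :=
      measurePreserving_orbitAverage_dirac hS.measurable hy'
    have h2 := (hlower _ hinv (n + E)).trans
      (mul_le_mul_of_nonneg_left (hmax _ hinv) (Nat.cast_nonneg _))
    have h3 : F n y = F n y' := hL.fiberMin_eq hag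
    have h4 := hsup n E y'
    have h5 : k ≤ F E ((leftShift Y)^[n] y') := hk ⟨_, rfl⟩
    have h6 : F (n + E) y' - C ≤ (n + E : ℕ) * β := h1.trans h2
    push_cast at h6
    linarith
  have hint : ∀ (n : ℕ) (ν : ProbabilityMeasure Y.carrier), ∫ y, (F n y - n * β)
      ∂(ν : Measure Y.carrier) = ∫ y, F n y ∂(ν : Measure Y.carrier) - n * β := fun n ν => by
    rw [integral_sub (integrable_of_continuous (hF n) _) (integrable_const _)]
    simp
  have hbelow : ∀ n : ℕ, n ≠ 0 → ∀ y ∈ (ν₁ : Measure Y.carrier).support,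
      -(2 * C + K + 1) ≤ F n y - n * β := fun n hn y hy => by
    refine le_of_mem_support (G := fun n y => F n y - n * β) hν₀i
      (fun n => (hF n).sub continuous_const) (fun n m y => ?_) hK (c := -C) (fun N => ?_) hn
      (hsupp hy)
    · have := hsub n m y
      push_cast
      linarith
    · rw [hint]
      rcases eq_or_ne N 0 with rfl | hN
      · have h0 : ∀ y, F 0 y = 0 := fun y => by simp [hFdef, fiberMin]
        simpa [h0] using hC
      · linarith [hupper ν₀ hν₀i N hN]
  have hβ₁ : β ≤ ψ ν₁ := by
    by_contra! hlt
    -- At this time the linear deficit `N * (β - ψ ν₁)` exceeds the uniform lower bound on the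
    -- support; `N + 1` is used to have a nonzero time.
    obtain ⟨N, hN⟩ := exists_nat_gt ((2 * C + K + 1) / (β - ψ ν₁))
    rw [div_lt_iff₀ (sub_pos.2 hlt)] at hN
    have h1 : ∫ _, -(2 * C + K + 1) ∂(ν₁ : Measure Y.carrier) ≤
        ∫ y, (F (N + 1) y - (N + 1 : ℕ) * β) ∂(ν₁ : Measure Y.carrier) :=
      integral_mono_ae (integrable_const _)
        (integrable_of_continuous ((hF _).sub continuous_const) _)
        (Filter.mem_of_superset Measure.support_mem_ae (hbelow (N + 1) N.succ_ne_zero))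
    rw [hint] at h1
    have h2 := hlower ν₁ hν₁ (N + 1)
    push_cast at h1 h2
    simp only [integral_const, probReal_univ, one_smul] at h1
    nlinarith
  exact ⟨hν₁, fun ν hν => (hmax ν hν).trans hβ₁⟩
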